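/- Let $S$ be a closed connected Riemann surface, let $G$ be a finite group acting faithfully and conformally on $S$, let $T=S/G$ be the quotient orbifold with projection $\pi\colon S\to T$, and let $T^\circ\subset T$ and $S^\circ=\pi^{-1}(T^\circ)$ be the surfaces obtained by removing the cone points of $T$ and the points over them, so that $\pi\colon S^\circ\to T^\circ$ is a regular covering with deck transformation group $G$. A cut system on $T$ is a finite graph $\mathcal E$ embedded in $T$ (loops allowed) such that every cone point is a vertex; the edges are smooth arcs that meet only at vertices and have definite tangents at their end points, the tangents at any given vertex being distinct; no regular point of $T$ is a terminal vertex; and $T-\mathcal E$ is an open disc. The lifted open polygons are the connected components of $S-\pi^{-1}(\mathcal E)$, and the edges lying over an edge $e$ of $\mathcal E$ are the connected components of the preimage of the open arc $e$. There is an edge collapse at an edge $\tilde e$ lying over $e$ if both sides of $\tilde e$ lie in one and the same lifted open polygon $P$ (that is, $\tilde e$ has an open neighbourhood $N$ with $N-\tilde e\subset P$), so that the closure of $P$ is glued to itself along $\tilde e$. A crossover loop for $e$ is a simple loop $\delta_e$ in $T^\circ$, based at a point $v_0\in T-\mathcal E$, that meets $\mathcal E$ exactly once, at an interior point of $e$,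 where it crosses $e$ transversally. Fix a point $\tilde v_0\in S$ over $v_0$, and let $\xi\colon\pi_1(T^\circ,v_0)\to G$ be the monodromy determined by $\tilde v_0$: the lift of a loop $\gamma$ that starts at $\tilde v_0$ ends at $\xi(\gamma)\tilde v_0$. The crossover transformation of $e$ is $\tau_e=\xi(\delta_e)$. Let $e$ be an edge of a cut system $\mathcal E$ on $T$. Then, for any choice of $v_0$, $\tilde v_0$ and of the crossover loop $\delta_e$, there is an edge collapse at every edge of $S$ lying over $e$ if and only if $\tau_e$ is the identity of $G$. -/

import Mathlib

open Set Filter Topology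
open scoped Manifold ContDiff unitInterval

/-- A conformal action of the group `G` on the Riemann surface `S`: a faithful action by
holomorphic maps (so every element acts as a conformal automorphism, and `G → Aut(S)` is
injective). -/
class IsConformalAction (G S : Type*) [Group G] [TopologicalSpace S] [ChartedSpace ℂ S]
    [MulAction G S] : Prop extends FaithfulSMul G S where
  mdifferentiable_smul : ∀ g : G, MDifferentiable 𝓘(ℂ) 𝓘(ℂ) (fun x : S => g • x)

theorem IsConformalAction.continuousConstSMul (G S : Type*) [Group G] [TopologicalSpace S]
    [ChartedSpace ℂ S] [MulAction G S] [h : IsConformalAction G S] :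
    ContinuousConstSMul G S :=
  ⟨fun g => (h.mdifferentiable_smul g).continuous⟩

/-! ### The quotient orbifold `T = S/G` -/

/-- The underlying space `T = S/G` of the quotient orbifold, with the quotient topology. -/
abbrev QuotientOrbifold (G S : Type*) [Group G] [MulAction G S] : Type _ :=
  MulAction.orbitRel.Quotient G S

/-- The quotient map `π_G : S → T`. -/
def orbifoldProj (G S : Type*) [Group G] [MulAction G S] (x : S) : QuotientOrbifold G S :=
  Quotient.mk (MulAction.orbitRel G S) x

/-- The cone points of `T`: the images of the points of `S` with non-trivial stabilizer. -/
def conePoints (G S : Type*) [Group G] [MulAction G S] : Set (QuotientOrbifold G S) :=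
  orbifoldProj G S '' {x | MulAction.stabilizer G x ≠ ⊥}

/-- `T°`, the quotient with the cone points removed. -/
abbrev PuncturedQuotient (G S : Type*) [Group G] [MulAction G S] : Type _ :=
  {p : QuotientOrbifold G S // p ∉ conePoints G S}

/-- `S°`, the surface with all the points lying over cone points removed. -/
def regularPoints (G S : Type*) [Group G] [MulAction G S] : SubMulAction G S where
  carrier := {x | MulAction.stabilizer G x = ⊥}
  smul_mem' g x hx := by
    change MulAction.stabilizer G (g • x) = ⊥
    rw [MulAction.stabilizer_smul_eq_stabilizer_map_conj,
      show MulAction.stabilizer G x = ⊥ from hx, Subgroup.map_bot]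

theorem orbifoldProj_eq_iff {G S : Type*} [Group G] [MulAction G S] {x y : S} :
    orbifoldProj G S x = orbifoldProj G S y ↔ x ∈ MulAction.orbit G y :=
  Quotient.eq''

theorem orbifoldProj_mem_conePoints_iff {G S : Type*} [Group G] [MulAction G S] (x : S) :
    orbifoldProj G S x ∈ conePoints G S ↔ x ∉ regularPoints G S := by
  constructor
  · rintro ⟨y, hy, hyx⟩ hx
    obtain ⟨g, rfl⟩ := orbifoldProj_eq_iff.1 hyx
    exact hy ((regularPoints G S).smul_mem g hx)
  · exact fun hx => ⟨x, hx, rfl⟩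

/-- The projection `π_G : S° → T°`. -/
def regularProj (G S : Type*) [Group G] [MulAction G S] (x : regularPoints G S) :
    PuncturedQuotient G S :=
  ⟨orbifoldProj G S x, fun h => (orbifoldProj_mem_conePoints_iff (x : S)).1 h x.2⟩

/-- `π_G : S° → T°` is a regular covering with deck transformation group `G`. -/
theorem isQuotientCoveringMap_regularProj (G S : Type*) [Group G] [Finite G]
    [TopologicalSpace S] [T2Space S] [CompactSpace S] [ChartedSpace ℂ S] [MulAction G S]
    [IsConformalAction G S] : IsQuotientCoveringMap (regularProj G S) G := by
  have := IsConformalAction.continuousConstSMul G S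
  have hopen : IsOpen (regularPoints G S : Set S) := by
    have h : (regularPoints G S : Set S) = ⋂ g ∈ {g : G | g ≠ 1}, {x : S | g • x = x}ᶜ := by
      ext x
      change MulAction.stabilizer G x = ⊥ ↔ _
      rw [Subgroup.eq_bot_iff_forall]
      simp only [mem_iInter, mem_compl_iff, mem_ofPred_eq, MulAction.mem_stabilizer_iff]
      exact ⟨fun h g hg hx => hg (h g hx), fun h g hx => by_contra fun hg => h g hg hx⟩
    rw [h]
    exact (Set.toFinite _).isOpen_biInter fun g _ =>
      (isClosed_eq (continuous_const_smul g) continuous_id).isOpen_compl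
  have : LocallyCompactSpace (regularPoints G S) := hopen.locallyCompactSpace
  have : ContinuousConstSMul G (regularPoints G S) :=
    ⟨fun g => ((continuous_const_smul g).comp continuous_subtype_val).subtype_mk _⟩
  have : IsCancelSMul G (regularPoints G S) :=
    isCancelSMul_iff_eq_one_of_smul_eq.mpr fun g x hx => by
      have h2 : MulAction.stabilizer G (x : S) = ⊥ := x.2
      have h1 : g ∈ MulAction.stabilizer G (x : S) := congrArg Subtype.val hx
      rw [h2] at h1
      exact h1
  have hpo : IsOpenMap (orbifoldProj G S) := isOpenMap_quotient_mk'_mul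
  have hpc : Continuous (orbifoldProj G S) := continuous_quotient_mk'
  have hq : IsQuotientMap (regularProj G S) := by
    refine IsOpenMap.isQuotientMap ?_ ((hpc.comp continuous_subtype_val).subtype_mk _) ?_
    · intro U hU
      rw [isOpen_induced_iff]
      refine ⟨orbifoldProj G S '' (Subtype.val '' U), hpo _ (hopen.isOpenMap_subtype_val _ hU), ?_⟩
      ext p
      constructor
      · rintro ⟨_, ⟨x, hx, rfl⟩, hp⟩
        exact ⟨x, hx, Subtype.ext hp⟩
      · rintro ⟨x, hx, rfl⟩
        exact ⟨x, ⟨x, hx, rfl⟩, rfl⟩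
    · rintro ⟨p, hp⟩
      obtain ⟨x, rfl⟩ := Quotient.exists_rep p
      exact ⟨⟨x, by_contra fun hx => hp ((orbifoldProj_mem_conePoints_iff x).2 hx)⟩, rfl⟩
  refine hq.isQuotientCoveringMap_of_properlyDiscontinuousSMul ?_
  intro x y
  rw [Subtype.ext_iff]
  refine orbifoldProj_eq_iff.trans ?_
  constructor
  · rintro ⟨g, hg⟩
    exact ⟨g, Subtype.ext hg⟩
  · rintro ⟨g, rfl⟩
    exact ⟨g, rfl⟩

/-- The monodromy `ξ` determined by the lift `x₀` of the base point `v₀`: if the lift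
starting at `x₀` of a loop `γ` ends at `g • x₀`, then `ξ(γ) = g`.  It is a homomorphism when loops
are multiplied by running through the left factor first; Mathlib multiplies loops in the
opposite order, whence the opposite group. -/
noncomputable def monodromyHom {G S : Type*} [Group G] [Finite G]
    [TopologicalSpace S] [T2Space S] [CompactSpace S] [ChartedSpace ℂ S] [MulAction G S]
    [IsConformalAction G S] {v₀ : PuncturedQuotient G S} (x₀ : regularProj G S ⁻¹' {v₀}) :
    FundamentalGroup (PuncturedQuotient G S) v₀ →* Gᵐᵒᵖ :=
  (isQuotientCoveringMap_regularProj G S).fundamentalGroupToMulOpposite x₀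

/-- A holomorphic chart of `T` for the conformal structure induced from `S`: a homeomorphism from
an open subset of `T` onto an open subset of `ℂ` whose pull-back to `S` is holomorphic. -/
def IsQuotientChart (G S : Type*) [Group G] [TopologicalSpace S] [ChartedSpace ℂ S]
    [MulAction G S] (φ : OpenPartialHomeomorph (QuotientOrbifold G S) ℂ) : Prop :=
  MDifferentiableOn 𝓘(ℂ) 𝓘(ℂ) (fun x : S => φ (orbifoldProj G S x))
    (orbifoldProj G S ⁻¹' φ.source)

/-! ### Cut systems -/

/-- A finite graph embedded in `T` (loops and multiple edges are allowed): finitely many vertices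
and `k` arcs, parametrized by `[0, 1]`, which join vertices and meet only at vertices. -/
structure EmbeddedGraph (G S : Type*) [Group G] [TopologicalSpace S] [MulAction G S] where
  vertices : Set (QuotientOrbifold G S)
  finite_vertices : vertices.Finite
  k : ℕ
  arc : Fin k → ℝ → QuotientOrbifold G S
  continuousOn_arc : ∀ e, ContinuousOn (arc e) (Icc 0 1)
  arc_zero_mem : ∀ e, arc e 0 ∈ vertices
  arc_one_mem : ∀ e, arc e 1 ∈ vertices
  arc_notMem : ∀ e, ∀ t ∈ Ioo (0 : ℝ) 1, arc e t ∉ vertices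
  injOn_arc : ∀ e, InjOn (arc e) (Ioo 0 1)
  disjoint_arc : ∀ e e', e ≠ e' → Disjoint (arc e '' Ioo 0 1) (arc e' '' Ioo 0 1)

namespace EmbeddedGraph

variable {G S : Type*} [Group G] [TopologicalSpace S] [MulAction G S] (Γ : EmbeddedGraph G S)

/-- The open edge (the arc without its end points). -/
def openEdge (e : Fin Γ.k) : Set (QuotientOrbifold G S) := Γ.arc e '' Ioo 0 1

/-- The graph as a subset of `T`. -/
def support : Set (QuotientOrbifold G S) := Γ.vertices ∪ ⋃ e, Γ.openEdge e

/-- The two half-edges of `e`: the arc parametrized from its start (`false`), or backwards from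
its end (`true`). -/
def halfEdge (h : Fin Γ.k × Bool) (t : ℝ) : QuotientOrbifold G S :=
  if h.2 then Γ.arc h.1 (1 - t) else Γ.arc h.1 t

/-- The half-edges issuing from `v`; their number is the valence of `v`. -/
def halfEdgesAt (v : QuotientOrbifold G S) : Set (Fin Γ.k × Bool) :=
  {h | Γ.halfEdge h 0 = v}

end EmbeddedGraph

/-- The curve `c` in `ℂ` has the definite tangent direction `u` at its starting point `c 0`. -/
def HasTangentDirection (c : ℝ → ℂ) (u : ℂ) : Prop :=
  Tendsto (fun t : ℝ => ‖c t - c 0‖⁻¹ • (c t - c 0)) (𝓝[>] 0) (𝓝 u)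

/-- A cut system on `T = S/G`. -/
structure CutSystem (G S : Type*) [Group G] [TopologicalSpace S] [ChartedSpace ℂ S]
    [MulAction G S] extends EmbeddedGraph G S where
  /-- Every cone point is a vertex. -/
  conePoints_subset : conePoints G S ⊆ vertices
  /-- The edges are smooth (regular) arcs. -/
  smooth_arc : ∀ e, ∀ t ∈ Ioo (0 : ℝ) 1,
    ∃ φ : OpenPartialHomeomorph (QuotientOrbifold G S) ℂ, IsQuotientChart G S φ ∧
      arc e t ∈ φ.source ∧ ContDiffAt ℝ ∞ (fun s => φ (arc e s)) t ∧
      deriv (fun s => φ (arc e s)) t ≠ 0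
  /-- At every vertex the half-edges have definite tangents, and these are distinct. -/
  tangents : ∀ v ∈ vertices,
    ∃ φ : OpenPartialHomeomorph (QuotientOrbifold G S) ℂ, IsQuotientChart G S φ ∧ v ∈ φ.source ∧
      ∃ u : Fin k × Bool → ℂ, InjOn u (toEmbeddedGraph.halfEdgesAt v) ∧
        ∀ h ∈ toEmbeddedGraph.halfEdgesAt v,
          HasTangentDirection (fun t => φ (toEmbeddedGraph.halfEdge h t)) (u h)
  /-- A regular point is not a terminal vertex. -/
  not_terminal : ∀ v ∈ vertices, v ∉ conePoints G S → (toEmbeddedGraph.halfEdgesAt v).ncard ≠ 1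
  /-- The complement of the graph is an open disc. -/
  complement_disc :
    Nonempty ((toEmbeddedGraph.supportᶜ : Set (QuotientOrbifold G S)) ≃ₜ Metric.ball (0 : ℂ) 1)

namespace CutSystem

variable {G S : Type*} [Group G] [TopologicalSpace S] [ChartedSpace ℂ S] [MulAction G S]
  (𝓔 : CutSystem G S)

/-! ### Lifts to `S` -/

/-- The lifted graph `π_G⁻¹(𝓔)`. -/
def liftedSupport : Set S := orbifoldProj G S ⁻¹' 𝓔.support

/-- The lifted open polygons: the connected components of the complement of the lifted graph. -/
def IsLiftedPolygon (P : Set S) : Prop :=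
  ∃ x ∈ 𝓔.liftedSupportᶜ, P = connectedComponentIn 𝓔.liftedSupportᶜ x

/-- The (open) edges lying over `e`: the connected components of the preimage of the open
edge `e`. -/
def IsLiftedEdge (e : Fin 𝓔.k) (l : Set S) : Prop :=
  ∃ x ∈ orbifoldProj G S ⁻¹' 𝓔.openEdge e,
    l = connectedComponentIn (orbifoldProj G S ⁻¹' 𝓔.openEdge e) x

/-- There is an edge collapse at the lifted open edge `l`: some neighbourhood `N` of `l` is cut by
`l` into parts (the halves of a ribbon around `l`) that all lie in one and the same lifted open
polygon `P`.  So both sides of `l` belong to `P`, and the closure of `P` is glued to itself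
along `l`. -/
def EdgeCollapse (l : Set S) : Prop :=
  ∃ P, 𝓔.IsLiftedPolygon P ∧ ∃ N : Set S, IsOpen N ∧ l ⊆ N ∧ N \ l ⊆ P

/-! ### Crossover loops and crossover transformations -/

/-- The loop `δ` in `T°` is a crossover loop for the edge `e`: its base point is in the open
polygon `T - 𝓔`, it is simple, it meets the graph exactly once, at an interior point of `e`, and
there it crosses `e` transversally (in a chart the velocities of `δ` and of `e` are linearly
independent over `ℝ`). -/
structure IsCrossoverLoop (e : Fin 𝓔.k) {v₀ : PuncturedQuotient G S} (δ : Path v₀ v₀) :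
    Prop where
  base_notMem : (v₀ : QuotientOrbifold G S) ∉ 𝓔.support
  simple : ∀ s t : I, δ s = δ t → s = t ∨ (s = 0 ∧ t = 1) ∨ (s = 1 ∧ t = 0)
  crossing : ∃ t₀ : I, ∃ x ∈ Ioo (0 : ℝ) 1,
    (δ t₀ : QuotientOrbifold G S) = 𝓔.arc e x ∧
    (∀ t : I, (δ t : QuotientOrbifold G S) ∈ 𝓔.support → t = t₀) ∧
    ∃ φ : OpenPartialHomeomorph (QuotientOrbifold G S) ℂ, IsQuotientChart G S φ ∧
      𝓔.arc e x ∈ φ.source ∧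
      ∃ a b : ℂ, HasDerivAt (fun s : ℝ => φ (𝓔.arc e s)) a x ∧
        HasDerivAt (fun s : ℝ => φ (δ.extend s : QuotientOrbifold G S)) b t₀ ∧
        LinearIndependent ℝ ![a, b]

end CutSystem

/-- The crossover transformation `τ = ξ(δ)` of a crossover loop `δ`, where `ξ` is the monodromy
determined by the lift `x₀` of the base point. -/
noncomputable def crossoverTransformation {G S : Type*} [Group G] [Finite G]
    [TopologicalSpace S] [T2Space S] [CompactSpace S] [ChartedSpace ℂ S] [MulAction G S]
    [IsConformalAction G S] {v₀ : PuncturedQuotient G S} (x₀ : regularProj G S ⁻¹' {v₀})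
    (δ : Path v₀ v₀) : G :=
  (monodromyHom x₀ (FundamentalGroup.fromPath (Path.Homotopic.Quotient.mk δ))).unop

/-! Lift the crossover loop to a path `Γ` from `x₀` to `τ x₀`. It meets the lifted graph exactly
once, at a point `z` over `e`. Before `z` it runs in the polygon of `x₀`, after `z` in the polygon
of `τ x₀` (`IsCrossoverLoop.exists_lift`).

If there is a collapse at the edge through `z`, the two polygons coincide, so `τ x₀` lies in the
polygon of `x₀`. As `T - 𝓔` is a disc without cone points, a polygon meets each orbit at most once
(`eq_one_of_smul_mem_polygon`), so `τ = 1`.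

If `τ = 1`, transversality puts points of `Γ` on both sides of the edge near `z`
(`IsEdgeBox.frequently_pos_and_neg`), so one polygon fills both sides there. This property is
locally constant along `e` and is carried by `G` from one point of a fibre to the others, so it
holds everywhere over `e`. Along one lifted edge the polygon does not change, and a union of small
boxes is the required ribbon (`edgeCollapse_of_eventually_mem_polygon`). The local picture is
`exists_isEdgeBox`: coordinates near a point over `e` that turn the lifted graph into a straight
line. -/

/-- The inverse of an injective holomorphic function is holomorphic. -/
theorem OpenPartialHomeomorph.differentiableOn_symm_of_complex (h : OpenPartialHomeomorph ℂ ℂ)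
    (hd : DifferentiableOn ℂ h h.source) : DifferentiableOn ℂ h.symm h.target := by
  intro w hw
  refine DifferentiableAt.differentiableWithinAt ?_
  set ζ := h.symm w with hζ
  have hζs : ζ ∈ h.source := h.map_target hw
  have han : AnalyticAt ℂ h ζ := hd.analyticAt (h.open_source.mem_nhds hζs)
  -- Zeros of the derivative are isolated: were it zero near `ζ`, `h` would be constant on a ball,
  -- against injectivity.
  have hne : ∀ᶠ z in 𝓝[≠] ζ, deriv h z ≠ 0 := by
    refine han.deriv.eventually_eq_zero_or_eventually_ne_zero.resolve_left fun h0 => ?_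
    obtain ⟨r, hr, hball⟩ := Metric.eventually_nhds_iff_ball.1
      (h0.and (h.open_source.mem_nhds hζs))
    have hconst : ∀ z ∈ Metric.ball ζ r, h z = h ζ := fun z hz =>
      (convex_ball ζ r).is_const_of_fderivWithin_eq_zero (𝕜 := ℂ)
        (fun y hy => (hd y (hball y hy).2).mono fun y hy => (hball y hy).2)
        (fun y hy => by
          rw [fderivWithin_of_isOpen Metric.isOpen_ball hy]
          ext
          simpa using (hball y hy).1) hz (Metric.mem_ball_self hr)
    have hmem : ζ + (r / 2 : ℝ) ∈ Metric.ball ζ r := by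
      simp [abs_of_pos hr, hr]
    have := h.injOn (hball _ hmem).2 hζs (hconst _ hmem)
    have h2 : ((r / 2 : ℝ) : ℂ) = 0 := by simpa using this
    have h3 : r / 2 = 0 := by exact_mod_cast h2
    linarith
  have hcont : ContinuousAt h.symm w := h.continuousAt_symm hw
  have hev : ∀ᶠ w' in 𝓝 w, w' ≠ w → DifferentiableAt ℂ h.symm w' := by
    have h1 := hcont.eventually (eventually_nhdsWithin_iff.1 hne)
    filter_upwards [h1, h.open_target.mem_nhds hw] with w' h2 hw' hww'
    have h3 : h.symm w' ≠ ζ := fun h4 => hww' (h.symm.injOn hw' hw h4)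
    exact (h.hasDerivAt_symm hw' (h2 h3)
      ((hd.differentiableAt (h.open_source.mem_nhds (h.map_target hw'))).hasDerivAt)).differentiableAt
  -- Removable singularity: the inverse is continuous at `w` and differentiable at the other points
  -- nearby.
  have := (Complex.differentiableOn_compl_singleton_and_continuousAt_iff hev).1
    ⟨fun y hy => (hy.1 hy.2).differentiableWithinAt, hcont⟩
  exact this.differentiableAt hev

/-! ### Topology of the quotient and of the embedded graph -/

section Quotient

variable {G S : Type*} [Group G] [TopologicalSpace S] [MulAction G S]

theorem continuous_orbifoldProj : Continuous (orbifoldProj G S) := continuous_quotient_mk'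

theorem orbifoldProj_smul {G S : Type*} [Group G] [MulAction G S] (g : G) (x : S) : orbifoldProj G S (g • x) = orbifoldProj G S x :=
  orbifoldProj_eq_iff.2 ⟨g, rfl⟩

theorem surjective_orbifoldProj {G S : Type*} [Group G] [MulAction G S] :
    Function.Surjective (orbifoldProj G S) := Quotient.exists_rep

theorem t2Space_quotientOrbifold [Finite G] [T2Space S] [LocallyCompactSpace S]
    [ContinuousConstSMul G S] : T2Space (QuotientOrbifold G S) :=
  t2Space_of_properlyDiscontinuousSMul_of_t2Space

theorem EmbeddedGraph.notMem_conePoints_of_mem_openEdge {Γ : EmbeddedGraph G S}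
    (hΓ : conePoints G S ⊆ Γ.vertices) {e : Fin Γ.k} {p : QuotientOrbifold G S}
    (hp : p ∈ Γ.openEdge e) : p ∉ conePoints G S := by
  obtain ⟨t, ht, rfl⟩ := hp
  exact fun h => Γ.arc_notMem e t ht (hΓ h)

theorem EmbeddedGraph.openEdge_subset_support (Γ : EmbeddedGraph G S) (e : Fin Γ.k) :
    Γ.openEdge e ⊆ Γ.support :=
  (subset_iUnion Γ.openEdge e).trans subset_union_right

/-- A part of the graph that contains all vertices and is obtained by removing an open piece of the
edge `e` is closed. -/
theorem EmbeddedGraph.isClosed_support_diff [T2Space (QuotientOrbifold G S)]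
    (Γ : EmbeddedGraph G S) (e : Fin Γ.k) {a b : ℝ} (hab : Ioo a b ⊆ Ioo 0 1) :
    IsClosed (Γ.support \ Γ.arc e '' Ioo a b) := by
  -- Adding end points to the arcs changes nothing, since they are vertices; what remains is a
  -- finite union of closed sets.
  have h : Γ.support \ Γ.arc e '' Ioo a b = Γ.vertices ∪
      (⋃ e' ∈ {e' | e' ≠ e}, Γ.arc e' '' Icc 0 1) ∪ Γ.arc e '' (Icc 0 1 \ Ioo a b) := by
    have hIcc : ∀ {t : ℝ}, t ∈ Icc (0 : ℝ) 1 → t ∈ Ioo (0 : ℝ) 1 ∨ t = 0 ∨ t = 1 := by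
      intro t ht
      rcases eq_or_lt_of_le ht.1 with h0 | h0
      · exact Or.inr (Or.inl h0.symm)
      rcases eq_or_lt_of_le ht.2 with h1 | h1
      · exact Or.inr (Or.inr h1)
      exact Or.inl ⟨h0, h1⟩
    have hsupp : ∀ (e' : Fin Γ.k) {t : ℝ}, t ∈ Icc (0 : ℝ) 1 → Γ.arc e' t ∈ Γ.support := by
      intro e' t ht
      rcases hIcc ht with ht | rfl | rfl
      · exact Γ.openEdge_subset_support e' ⟨t, ht, rfl⟩
      · exact Or.inl (Γ.arc_zero_mem e')
      · exact Or.inl (Γ.arc_one_mem e')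
    ext p
    constructor
    · rintro ⟨hp | hp, hpn⟩
      · exact Or.inl (Or.inl hp)
      · obtain ⟨e', t, ht, rfl⟩ := mem_iUnion.1 hp
        by_cases he : e' = e
        · subst he
          exact Or.inr ⟨t, ⟨Ioo_subset_Icc_self ht, fun h => hpn ⟨t, h, rfl⟩⟩, rfl⟩
        · exact Or.inl (Or.inr (mem_biUnion he ⟨t, Ioo_subset_Icc_self ht, rfl⟩))
    · have hv : ∀ p ∈ Γ.vertices, p ∈ Γ.support \ Γ.arc e '' Ioo a b := by
        refine fun p hp => ⟨Or.inl hp, ?_⟩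
        rintro ⟨t, ht, rfl⟩
        exact Γ.arc_notMem e t (hab ht) hp
      rintro ((hp | hp) | ⟨t, ht, rfl⟩)
      · exact hv p hp
      · obtain ⟨e', he', t, ht, rfl⟩ := mem_iUnion₂.1 hp
        rcases hIcc ht with ht' | rfl | rfl
        · refine ⟨hsupp e' ht, ?_⟩
          rintro ⟨s, hs, hst⟩
          exact disjoint_left.1 (Γ.disjoint_arc e' e he') ⟨t, ht', rfl⟩ ⟨s, hab hs, hst⟩
        · exact hv _ (Γ.arc_zero_mem e')
        · exact hv _ (Γ.arc_one_mem e')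
      · rcases hIcc ht.1 with ht' | rfl | rfl
        · refine ⟨hsupp e ht.1, ?_⟩
          rintro ⟨s, hs, hst⟩
          exact ht.2 (Γ.injOn_arc e (hab hs) ht' hst ▸ hs)
        · exact hv _ (Γ.arc_zero_mem e)
        · exact hv _ (Γ.arc_one_mem e)
  rw [h]
  refine (Γ.finite_vertices.isClosed.union ?_).union ?_
  · exact (Set.toFinite _).isClosed_biUnion fun e' _ =>
      (isCompact_Icc.image_of_continuousOn (Γ.continuousOn_arc e')).isClosed
  · exact ((isCompact_Icc.diff isOpen_Ioo).image_of_continuousOn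
      ((Γ.continuousOn_arc e).mono sdiff_subset)).isClosed

theorem EmbeddedGraph.isClosed_support [T2Space (QuotientOrbifold G S)]
    (Γ : EmbeddedGraph G S) : IsClosed Γ.support := by
  have h : Γ.support = Γ.vertices ∪ ⋃ e, Γ.arc e '' Icc 0 1 := by
    refine subset_antisymm
      (union_subset_union_right _ (iUnion_mono fun e => image_mono Ioo_subset_Icc_self)) ?_
    refine union_subset subset_union_left (iUnion_subset fun e => ?_)
    rintro _ ⟨t, ht, rfl⟩
    rcases eq_or_lt_of_le ht.1 with rfl | h0
    · exact Or.inl (Γ.arc_zero_mem e)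
    rcases eq_or_lt_of_le ht.2 with rfl | h1
    · exact Or.inl (Γ.arc_one_mem e)
    exact Γ.openEdge_subset_support e ⟨t, ⟨h0, h1⟩, rfl⟩
  rw [h]
  exact Γ.finite_vertices.isClosed.union (isClosed_iUnion_of_finite fun e =>
    (isCompact_Icc.image_of_continuousOn (Γ.continuousOn_arc e)).isClosed)

end Quotient

/-! ### The projection near regular points -/

section LocalHomeomorph

variable {G S : Type*} [Group G] [Finite G] [TopologicalSpace S] [T2Space S]
  [ChartedSpace ℂ S] [MulAction G S] [IsConformalAction G S]

theorem isOpen_regularPoints : IsOpen (regularPoints G S : Set S) := by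
  have := IsConformalAction.continuousConstSMul G S
  have h : (regularPoints G S : Set S) = ⋂ g ∈ {g : G | g ≠ 1}, {x : S | g • x = x}ᶜ := by
    ext x
    change MulAction.stabilizer G x = ⊥ ↔ _
    rw [Subgroup.eq_bot_iff_forall]
    simp only [mem_iInter, mem_compl_iff, mem_ofPred_eq, MulAction.mem_stabilizer_iff]
    exact ⟨fun h g hg hx => hg (h g hx), fun h g hx => by_contra fun hg => h g hg hx⟩
  rw [h]
  exact (Set.toFinite _).isOpen_biInter fun g _ =>
    (isClosed_eq (continuous_const_smul g) continuous_id).isOpen_compl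

theorem isOpen_compl_conePoints : IsOpen (conePoints G S)ᶜ := by
  have h : orbifoldProj G S ⁻¹' (conePoints G S)ᶜ = regularPoints G S := by
    ext x
    simpa using (orbifoldProj_mem_conePoints_iff (G := G) x).not_left
  exact isQuotientMap_quotient_mk'.isOpen_preimage.1 (h ▸ isOpen_regularPoints)

/-- Near a regular point, `π` is a homeomorphism onto an open subset. -/
theorem exists_openPartialHomeomorph_orbifoldProj [CompactSpace S] {z : S} (hz : z ∈ regularPoints G S) :
    ∃ q : OpenPartialHomeomorph S (QuotientOrbifold G S), z ∈ q.source ∧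
      (q : S → QuotientOrbifold G S) = orbifoldProj G S := by
  have h1 : IsLocalHomeomorph (regularProj G S) :=
    (isQuotientCoveringMap_regularProj G S).isCoveringMap.isLocalHomeomorph
  have h2 : IsLocalHomeomorph ((↑) : PuncturedQuotient G S → QuotientOrbifold G S) :=
    isOpen_compl_conePoints.isOpenEmbedding_subtypeVal.isLocalHomeomorph
  have h3 : IsLocalHomeomorph ((↑) : regularPoints G S → S) :=
    isOpen_regularPoints.isOpenEmbedding_subtypeVal.isLocalHomeomorph
  have h4 : IsLocalHomeomorph (orbifoldProj G S ∘ ((↑) : regularPoints G S → S)) :=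
    h2.comp h1
  have h5 : IsLocalHomeomorphOn (orbifoldProj G S) (regularPoints G S : Set S) := by
    refine IsLocalHomeomorphOn.mk _ _ fun x hx => ?_
    obtain ⟨q, hq, hqe⟩ := h4 ⟨x, hx⟩
    obtain ⟨c, hc, hce⟩ := h3 ⟨x, hx⟩
    have hcx : c ⟨x, hx⟩ = x := (congrFun hce ⟨x, hx⟩).symm
    -- Precomposing with a local inverse of the inclusion of `S°` makes the local homeomorphism
    -- start from `S`.
    refine ⟨c.symm.trans q, ?_, fun y hy => ?_⟩
    · rw [OpenPartialHomeomorph.trans_source]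
      exact ⟨hcx ▸ c.map_source hc, by rwa [mem_preimage, ← hcx, c.left_inv hc]⟩
    · rw [OpenPartialHomeomorph.trans_source] at hy
      have h6 : ((c.symm y : regularPoints G S) : S) = y :=
        (congrFun hce _).trans (c.right_inv hy.1)
      rw [OpenPartialHomeomorph.trans_apply, ← hqe, Function.comp_apply, h6]
  obtain ⟨q, hq, hqe⟩ := h5 z hz
  exact ⟨q, hq, hqe.symm⟩

end LocalHomeomorph

/-! ### Transition maps between quotient charts -/

section Transition

variable {G S : Type*} [Group G] [Finite G] [TopologicalSpace S] [T2Space S] [CompactSpace S]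
  [ChartedSpace ℂ S] [IsManifold 𝓘(ℂ) ω S] [MulAction G S] [IsConformalAction G S]

/-- A quotient chart, read in a chart of `S`, is holomorphic. -/
theorem IsQuotientChart.differentiableAt_comp_chart_symm {G S : Type*} [Group G]
    [TopologicalSpace S] [ChartedSpace ℂ S] [IsManifold 𝓘(ℂ) ω S] [MulAction G S]
    {φ : OpenPartialHomeomorph (QuotientOrbifold G S) ℂ} (hφ : IsQuotientChart G S φ) (z : S)
    {ζ : ℂ} (hζ : ζ ∈ (chartAt ℂ z).target)
    (hs : orbifoldProj G S ((chartAt ℂ z).symm ζ) ∈ φ.source) :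
    DifferentiableAt ℂ (fun ζ => φ (orbifoldProj G S ((chartAt ℂ z).symm ζ))) ζ := by
  have : IsManifold 𝓘(ℂ) 1 S := IsManifold.of_le (n := ω) (by simp)
  rw [← mdifferentiableAt_iff_differentiableAt]
  have h1 : MDifferentiableAt 𝓘(ℂ) 𝓘(ℂ) (fun x : S => φ (orbifoldProj G S x))
      ((chartAt ℂ z).symm ζ) :=
    (hφ _ hs).mdifferentiableAt
      ((φ.open_source.preimage continuous_orbifoldProj).mem_nhds hs)
  exact h1.comp ζ (mdifferentiableAt_atlas_symm (chart_mem_atlas ℂ z) hζ)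

/-- Quotient charts are holomorphic only after pull-back to `S`. With a chart `χ` at a regular point
over `p`, the transition is `φ₁ ∘ π ∘ χ⁻¹` after the inverse of `H = φ₂ ∘ π ∘ χ⁻¹`. Regularity makes
`π`, hence `H`, locally injective, so that the inverse of `H` is holomorphic. -/
theorem IsQuotientChart.differentiableAt_transition
    {φ₁ φ₂ : OpenPartialHomeomorph (QuotientOrbifold G S) ℂ} (h₁ : IsQuotientChart G S φ₁)
    (h₂ : IsQuotientChart G S φ₂) {p : QuotientOrbifold G S} (hp : p ∉ conePoints G S)
    (hp₁ : p ∈ φ₁.source) (hp₂ : p ∈ φ₂.source) :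
    DifferentiableAt ℂ (fun w => φ₁ (φ₂.symm w)) (φ₂ p) := by
  obtain ⟨z, rfl⟩ := surjective_orbifoldProj p
  have hz : z ∈ regularPoints G S := by
    simpa using (orbifoldProj_mem_conePoints_iff (G := G) z).not.1 hp
  obtain ⟨q, hzq, hq⟩ := exists_openPartialHomeomorph_orbifoldProj hz
  set χ := chartAt ℂ z with hχ
  have hzχ : z ∈ χ.source := mem_chart_source ℂ z
  set H := (χ.symm.trans q).trans φ₂ with hH
  have hHe : ∀ ζ, H ζ = φ₂ (orbifoldProj G S (χ.symm ζ)) := fun ζ => by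
    simp [hH, hq]
  have hsrc : χ z ∈ H.source := by
    simp [hH, hq, hzχ, hzq, hp₂]
  have hHd : DifferentiableOn ℂ H H.source := by
    intro ζ hζ
    simp only [hH, OpenPartialHomeomorph.trans_source, OpenPartialHomeomorph.symm_source,
      OpenPartialHomeomorph.coe_trans, mem_inter_iff, mem_preimage, Function.comp_apply, hq] at hζ
    have := h₂.differentiableAt_comp_chart_symm z hζ.1.1 hζ.2
    refine DifferentiableAt.differentiableWithinAt ?_
    exact this.congr_of_eventuallyEq (Eventually.of_forall hHe)
  have hHz : H (χ z) = φ₂ (orbifoldProj G S z) := by rw [hHe, χ.left_inv hzχ]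
  have htgt : φ₂ (orbifoldProj G S z) ∈ H.target := hHz ▸ H.map_source hsrc
  have hsymm : DifferentiableAt ℂ H.symm (φ₂ (orbifoldProj G S z)) :=
    (H.differentiableOn_symm_of_complex hHd).differentiableAt (H.open_target.mem_nhds htgt)
  have hHs : H.symm (φ₂ (orbifoldProj G S z)) = χ z := by rw [← hHz, H.left_inv hsrc]
  have hd₁ : DifferentiableAt ℂ (fun ζ => φ₁ (orbifoldProj G S (χ.symm ζ)))
      (H.symm (φ₂ (orbifoldProj G S z))) := by
    rw [hHs]
    exact h₁.differentiableAt_comp_chart_symm z (χ.map_source hzχ) (by rwa [χ.left_inv hzχ])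
  refine (hd₁.comp _ hsymm).congr_of_eventuallyEq ?_
  filter_upwards [H.open_target.mem_nhds htgt] with w hw
  have h3 : φ₂ (orbifoldProj G S (χ.symm (H.symm w))) = w := by rw [← hHe, H.right_inv hw]
  have h4 : orbifoldProj G S (χ.symm (H.symm w)) ∈ φ₂.source := by
    have := H.map_target hw
    simp only [hH, OpenPartialHomeomorph.trans_source,
      OpenPartialHomeomorph.coe_trans, mem_inter_iff, mem_preimage, Function.comp_apply, hq] at this
    exact this.2
  rw [Function.comp_apply, ← φ₂.left_inv h4, h3]

/-- The transition map between two quotient charts at a regular point of `T` has a nonzero complex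
derivative. -/
theorem IsQuotientChart.exists_hasDerivAt_transition
    {φ₁ φ₂ : OpenPartialHomeomorph (QuotientOrbifold G S) ℂ} (h₁ : IsQuotientChart G S φ₁)
    (h₂ : IsQuotientChart G S φ₂) {p : QuotientOrbifold G S} (hp : p ∉ conePoints G S)
    (hp₁ : p ∈ φ₁.source) (hp₂ : p ∈ φ₂.source) :
    ∃ c : ℂ, c ≠ 0 ∧ HasDerivAt (fun w => φ₁ (φ₂.symm w)) c (φ₂ p) := by
  have d₁ := (h₁.differentiableAt_transition h₂ hp hp₁ hp₂).hasDerivAt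
  have d₂ := (h₂.differentiableAt_transition h₁ hp hp₂ hp₁).hasDerivAt
  refine ⟨_, fun h0 => ?_, d₁⟩
  have hpt : φ₁ (φ₂.symm (φ₂ p)) = φ₁ p := by rw [φ₂.left_inv hp₂]
  -- The two transitions are mutually inverse, so a vanishing derivative would give the identity
  -- derivative `0`.
  have d₃ := HasDerivAt.comp (φ₂ p) (hpt.symm ▸ d₂) d₁
  rw [h0, mul_zero] at d₃
  have d₄ : HasDerivAt (fun w : ℂ => w) 0 (φ₂ p) := by
    refine d₃.congr_of_eventuallyEq ?_
    have hc : ContinuousAt φ₂.symm (φ₂ p) := φ₂.continuousAt_symm (φ₂.map_source hp₂)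
    filter_upwards [φ₂.open_target.mem_nhds (φ₂.map_source hp₂),
      hc (φ₁.open_source.mem_nhds ((φ₂.left_inv hp₂).symm ▸ hp₁))] with w hw hw₁
    rw [Function.comp_apply, φ₁.left_inv hw₁, φ₂.right_inv hw]
  exact zero_ne_one (d₄.unique (hasDerivAt_id _))

/-- The derivatives of a curve in `T` in two quotient charts differ by the derivative of the
transition map. -/
theorem HasDerivAt.quotientChart_transition {G S : Type*} [Group G] [TopologicalSpace S]
    [MulAction G S]
    {φ₁ φ₂ : OpenPartialHomeomorph (QuotientOrbifold G S) ℂ} {γ : ℝ → QuotientOrbifold G S}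
    {t : ℝ} {a c : ℂ} (hγ : HasDerivAt (fun s => φ₂ (γ s)) a t) (hc : ContinuousAt γ t)
    (hp₂ : γ t ∈ φ₂.source) (h : HasDerivAt (fun w => φ₁ (φ₂.symm w)) c (φ₂ (γ t))) :
    HasDerivAt (fun s => φ₁ (γ s)) (c * a) t := by
  have h1 := HasDerivAt.comp_of_eq (h₂ := fun w => φ₁ (φ₂.symm w)) t h hγ rfl
  refine h1.congr_of_eventuallyEq ?_
  filter_upwards [hc (φ₂.open_source.mem_nhds hp₂)] with s hs
  rw [Function.comp_apply, φ₂.left_inv hs]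

end Transition

/-! ### Straightening an edge -/

/-- A regular smooth curve in the plane can be straightened by a local homeomorphism; the first
order vanishing locus of the transverse coordinate is the tangent line. -/
theorem ContDiffAt.exists_straightening {γ : ℝ → ℂ} {x : ℝ} (hγ : ContDiffAt ℝ ∞ γ x)
    (h0 : deriv γ x ≠ 0) :
    ∃ F : OpenPartialHomeomorph (ℝ × ℝ) ℂ, (x, (0 : ℝ)) ∈ F.source ∧ (∀ s, F (s, 0) = γ s) ∧
      ∃ L : ℂ →L[ℝ] ℝ, HasFDerivAt (fun w => (F.symm w).2) L (γ x) ∧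
        ∀ v, L v = 0 → ∃ r : ℝ, v = r • deriv γ x := by
  set a := deriv γ x with ha
  let E : (ℝ × ℝ) ≃L[ℝ] ℂ := Complex.equivRealProdCLM.symm.trans
    ((ContinuousLinearEquiv.unitsEquivAut ℂ (Units.mk0 a h0)).restrictScalars ℝ)
  have hE : ∀ s t : ℝ, E (s, t) = (s + t * Complex.I) * a := fun s t => by
    simp [E, Complex.equivRealProdCLM_symm_apply]
  -- The curve is pushed off along its normal `i a`. The differential at `(x, 0)` is the isomorphism
  -- `E`, so the inverse function theorem applies.
  let f : ℝ × ℝ → ℂ := fun q => γ q.1 + q.2 • (Complex.I * a)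
  have hγ' : HasStrictDerivAt γ a x := hγ.hasStrictDerivAt (by simp)
  have hf : HasStrictFDerivAt f (E : ℝ × ℝ →L[ℝ] ℂ) (x, 0) := by
    have h1 : HasStrictFDerivAt (fun q : ℝ × ℝ => γ q.1) _ (x, (0 : ℝ)) :=
      HasStrictFDerivAt.comp (x, (0 : ℝ)) (hγ'.hasStrictFDerivAt) hasStrictFDerivAt_fst
    have h2 : HasStrictFDerivAt (fun q : ℝ × ℝ => q.2 • (Complex.I * a)) _ (x, (0 : ℝ)) :=
      (hasStrictFDerivAt_snd (𝕜 := ℝ) (p := (x, (0 : ℝ)))).smul_const (Complex.I * a)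
    convert! h1.add h2 using 1
    ext <;> simp [hE]
  refine ⟨hf.toOpenPartialHomeomorph f, hf.mem_toOpenPartialHomeomorph_source, fun s => ?_,
    (ContinuousLinearMap.snd ℝ ℝ ℝ).comp (E.symm : ℂ →L[ℝ] ℝ × ℝ), ?_, fun v hv => ?_⟩
  · simp [f]
  · have hfx : f (x, 0) = γ x := by simp [f]
    have h3 := hf.to_localInverse.hasFDerivAt
    rw [hfx] at h3
    exact hasFDerivAt_snd.comp (γ x) h3
  · refine ⟨(E.symm v).1, ?_⟩
    have h4 : E ((E.symm v).1, (E.symm v).2) = v := E.apply_symm_apply v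
    rw [show (E.symm v).2 = 0 from hv, hE] at h4
    simpa using h4.symm

/-! ### Edge boxes -/

namespace CutSystem

variable {G S : Type*} [Group G] [TopologicalSpace S] [ChartedSpace ℂ S] [MulAction G S]

/-- `U` is a small open subset of `S` that the lifted graph cuts into two halves along a piece of
an edge over `e` around a point over `𝓔.arc e x`; the function `ρ` is a transverse coordinate, which
vanishes on the edge and is positive on one half and negative on the other. -/
structure IsEdgeBox (𝓔 : CutSystem G S) (e : Fin 𝓔.k) (x : ℝ) (U : Set S) (ρ : S → ℝ) : Prop where
  isOpen : IsOpen U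
  mem_support_iff : ∀ w ∈ U, orbifoldProj G S w ∈ 𝓔.support ↔ ρ w = 0
  mem_openEdge : ∀ w ∈ U, ρ w = 0 → orbifoldProj G S w ∈ 𝓔.openEdge e
  isPreconnected : ∀ J : Set ℝ, Convex ℝ J → IsPreconnected {w ∈ U | ρ w ∈ J}
  exists_transversal : ∀ w ∈ U, ρ w = 0 →
    ∃ c : ℝ → S, ContinuousAt c 0 ∧ c 0 = w ∧ ∀ᶠ t in 𝓝 0, c t ∈ U ∧ ρ (c t) = t
  eventually_exists_arc : ∀ᶠ s in 𝓝 x, ∃ w ∈ U, orbifoldProj G S w = 𝓔.arc e s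
  exists_chart : ∃ φ : OpenPartialHomeomorph (QuotientOrbifold G S) ℂ, IsQuotientChart G S φ ∧
    𝓔.arc e x ∈ φ.source ∧ ∃ a : ℂ, HasDerivAt (fun s => φ (𝓔.arc e s)) a x ∧
      ∃ (h : ℂ → ℝ) (L : ℂ →L[ℝ] ℝ), HasFDerivAt h L (φ (𝓔.arc e x)) ∧
        (∀ w ∈ U, ρ w = h (φ (orbifoldProj G S w))) ∧ ∀ v, L v = 0 → ∃ r : ℝ, v = r • a

/-- The coordinate `k` is `π`, then a chart, then the straightening; the box corresponds to a small
ball `B` around `(x, 0)`, and `ρ` is the second coordinate. Convexity of `B` makes the slices `ρ ∈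
J` connected; the two halves and the edge piece are the cases of open half-lines and `{0}`. -/
theorem exists_isEdgeBox [Finite G] [T2Space S] [CompactSpace S] [IsConformalAction G S]
    (𝓔 : CutSystem G S) (e : Fin 𝓔.k) {x : ℝ} (hx : x ∈ Ioo (0 : ℝ) 1) {z : S}
    (hz : orbifoldProj G S z = 𝓔.arc e x) :
    ∃ U ρ, z ∈ U ∧ 𝓔.IsEdgeBox e x U ρ := by
  have := IsConformalAction.continuousConstSMul G S
  have : T2Space (QuotientOrbifold G S) := t2Space_quotientOrbifold
  obtain ⟨φ, hφ, hxφ, hsmooth, hderiv⟩ := 𝓔.smooth_arc e x hx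
  obtain ⟨F, hxF, hFγ, L, hL, hLker⟩ := hsmooth.exists_straightening hderiv
  have hzr : z ∈ regularPoints G S := by
    have := EmbeddedGraph.notMem_conePoints_of_mem_openEdge 𝓔.conePoints_subset
      (p := orbifoldProj G S z) (e := e) ⟨x, hx, hz.symm⟩
    simpa using (orbifoldProj_mem_conePoints_iff (G := G) z).not.1 this
  obtain ⟨q, hzq, hq⟩ := exists_openPartialHomeomorph_orbifoldProj hzr
  have harc : ContinuousAt (𝓔.arc e) x :=
    (𝓔.continuousOn_arc e).continuousAt (Icc_mem_nhds hx.1 hx.2)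
  have hline : ContinuousAt (fun s : ℝ => (s, (0 : ℝ))) x := by fun_prop
  -- On this interval the arc stays in the open edge and in the chart, and the line `(s, 0)` stays
  -- where `F` is injective.
  obtain ⟨ε, hε, hεI⟩ := Metric.eventually_nhds_iff_ball.1
    (((isOpen_Ioo.eventually_mem hx).and (harc.eventually (φ.open_source.eventually_mem hxφ))).and
      (hline.eventually (F.open_source.eventually_mem hxF)))
  rw [Real.ball_eq_Ioo] at hεI
  have hε01 : Ioo (x - ε) (x + ε) ⊆ Ioo 0 1 := fun s hs => (hεI s hs).1.1
  set k := (q.trans φ).trans F.symm with hk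
  have hkapp : ∀ w, k w = F.symm (φ (orbifoldProj G S w)) := fun w => by simp [hk, hq]
  have hksrc : ∀ w, w ∈ k.source ↔
      (w ∈ q.source ∧ orbifoldProj G S w ∈ φ.source) ∧ φ (orbifoldProj G S w) ∈ F.target :=
    fun w => by simp [hk, hq]
  have hγs : φ (𝓔.arc e x) = F (x, 0) := (hFγ x).symm
  have hzk : z ∈ k.source := by
    rw [hksrc, hz, hγs]
    exact ⟨⟨hzq, hxφ⟩, F.map_source hxF⟩
  have hkz : k z = (x, 0) := by rw [hkapp, hz, hγs, F.left_inv hxF]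
  -- Staying in `W` keeps the other edges, the vertices and the distant part of `e` out of the box.
  set W := (𝓔.support \ 𝓔.arc e '' Ioo (x - ε) (x + ε))ᶜ with hW
  have hWo : IsOpen (orbifoldProj G S ⁻¹' W) :=
    (𝓔.isClosed_support_diff e hε01).isOpen_compl.preimage continuous_orbifoldProj
  have hzW : z ∈ orbifoldProj G S ⁻¹' W := by
    rw [mem_preimage, hz]
    exact fun h => h.2 ⟨x, by constructor <;> linarith, rfl⟩
  have hnhds : k.target ∩ k.symm ⁻¹' (orbifoldProj G S ⁻¹' W) ∈ 𝓝 (x, (0 : ℝ)) := by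
    rw [← hkz]
    refine inter_mem (k.open_target.mem_nhds (k.map_source hzk)) ?_
    refine (k.continuousAt_symm (k.map_source hzk)) (hWo.mem_nhds ?_)
    rwa [k.left_inv hzk]
  obtain ⟨r₀, hr₀, hball⟩ := Metric.mem_nhds_iff.1 hnhds
  -- The bound by `ε` keeps the first coordinates of points of `B` in the chosen interval.
  set r := min r₀ ε with hr
  have hrpos : 0 < r := lt_min hr₀ hε
  set B := Metric.ball (x, (0 : ℝ)) r with hB
  have hBsub : B ⊆ k.target ∩ k.symm ⁻¹' (orbifoldProj G S ⁻¹' W) :=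
    (Metric.ball_subset_ball (min_le_left _ _)).trans hball
  have hBfst : ∀ b ∈ B, b.1 ∈ Ioo (x - ε) (x + ε) := by
    intro b hb
    rw [← Real.ball_eq_Ioo, Metric.mem_ball]
    exact (le_max_left _ _).trans_lt ((Metric.mem_ball.1 hb).trans_le (min_le_right _ _))
  have hU : ∀ b ∈ B, k.symm b ∈ k.source ∩ k ⁻¹' B := fun b hb =>
    ⟨k.map_target (hBsub hb).1, by rwa [mem_preimage, k.right_inv (hBsub hb).1]⟩
  have hFk : ∀ w ∈ k.source, F (k w) = φ (orbifoldProj G S w) := fun w hw => by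
    rw [hkapp, F.right_inv ((hksrc w).1 hw).2]
  have hedge : ∀ w ∈ k.source ∩ k ⁻¹' B, (k w).2 = 0 →
      orbifoldProj G S w = 𝓔.arc e (k w).1 := by
    rintro w ⟨hw, hwB⟩ h0
    have h1 := hFk w hw
    rw [show k w = ((k w).1, 0) from Prod.ext rfl h0, hFγ] at h1
    exact (φ.injOn (hεI _ (hBfst _ hwB)).1.2 ((hksrc w).1 hw).1.2 h1).symm
  refine ⟨k.source ∩ k ⁻¹' B, fun w => (k w).2, ⟨hzk, ?_⟩, ?_⟩
  · rw [mem_preimage, hkz]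
    exact Metric.mem_ball_self hrpos
  refine ⟨k.isOpen_inter_preimage Metric.isOpen_ball, ?_, ?_, ?_, ?_, ?_, ?_⟩
  · intro w hw
    constructor
    · intro hsupp
      have hwW : orbifoldProj G S w ∈ W := by
        have := (hBsub hw.2).2
        rwa [mem_preimage, k.left_inv hw.1] at this
      obtain ⟨s, hs, hsw⟩ : orbifoldProj G S w ∈ 𝓔.arc e '' Ioo (x - ε) (x + ε) :=
        by_contra fun h => hwW ⟨hsupp, h⟩
      change (k w).2 = 0
      rw [hkapp, ← hsw, ← hFγ, F.left_inv (hεI s hs).2]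
    · intro h0
      rw [hedge w hw h0]
      exact 𝓔.openEdge_subset_support e ⟨_, hε01 (hBfst _ hw.2), rfl⟩
  · intro w hw h0
    rw [hedge w hw h0]
    exact ⟨_, hε01 (hBfst _ hw.2), rfl⟩
  · intro J hJ
    have hset : {w ∈ k.source ∩ k ⁻¹' B | (k w).2 ∈ J} = k.symm '' (B ∩ Prod.snd ⁻¹' J) := by
      ext w
      constructor
      · rintro ⟨hw, hwJ⟩
        exact ⟨k w, ⟨hw.2, hwJ⟩, k.left_inv hw.1⟩
      · rintro ⟨b, ⟨hb, hbJ⟩, rfl⟩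
        refine ⟨hU b hb, ?_⟩
        rwa [k.right_inv (hBsub hb).1]
    rw [hset]
    refine ((convex_ball _ _).inter
      (hJ.linear_preimage (LinearMap.snd ℝ ℝ ℝ))).isPreconnected.image _ ?_
    exact k.continuousOn_symm.mono fun b hb => (hBsub hb.1).1
  · intro w hw h0
    have hwk : ((k w).1, (0 : ℝ)) = k w := Prod.ext rfl (Eq.symm h0)
    have hB0 : ((k w).1, (0 : ℝ)) ∈ B := by rw [hwk]; exact hw.2
    have hc : ContinuousAt (fun t : ℝ => ((k w).1, t)) 0 := by fun_prop
    refine ⟨fun t => k.symm ((k w).1, t), ?_, ?_, ?_⟩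
    · exact ContinuousAt.comp (f := fun t : ℝ => ((k w).1, t))
        (k.continuousAt_symm (hBsub hB0).1) hc
    · change k.symm ((k w).1, 0) = w
      rw [hwk, k.left_inv hw.1]
    · filter_upwards [hc (Metric.isOpen_ball.mem_nhds hB0)] with t ht
      exact ⟨hU _ ht, by rw [k.right_inv (hBsub ht).1]⟩
  · filter_upwards [hline (Metric.ball_mem_nhds _ hrpos)] with s hs
    refine ⟨_, hU _ hs, ?_⟩
    have h1 := k.right_inv (hBsub hs).1
    rw [hedge _ (hU _ hs) (by rw [h1]), h1]
  · exact ⟨φ, hφ, hxφ, _,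
      (hsmooth.differentiableAt (by simp)).hasDerivAt, fun w => (F.symm w).2, L, hL,
      fun w _ => by rw [hkapp], hLker⟩

end CutSystem

/-! ### Lifted polygons -/

namespace CutSystem

variable {G S : Type*} [Group G] [TopologicalSpace S] [ChartedSpace ℂ S] [MulAction G S]

/-- The lifted open polygon through `x`. -/
def polygon (𝓔 : CutSystem G S) (x : S) : Set S := connectedComponentIn 𝓔.liftedSupportᶜ x

variable (𝓔 : CutSystem G S)

theorem mem_polygon_self {x : S} (hx : x ∉ 𝓔.liftedSupport) : x ∈ 𝓔.polygon x :=
  mem_connectedComponentIn hx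

theorem polygon_eq {x y : S} (h : y ∈ 𝓔.polygon x) : 𝓔.polygon x = 𝓔.polygon y :=
  connectedComponentIn_eq h

/-- A connected set which avoids the lifted graph lies in the polygon of any of its points. -/
theorem subset_polygon {A : Set S} (hA : IsPreconnected A) (hAs : A ⊆ 𝓔.liftedSupportᶜ) {x y : S}
    (hxA : x ∈ A) (hxy : x ∈ 𝓔.polygon y) : A ⊆ 𝓔.polygon y :=
  𝓔.polygon_eq hxy ▸ hA.subset_connectedComponentIn hxA hAs

theorem IsLiftedPolygon.eq_polygon {P : Set S} (hP : 𝓔.IsLiftedPolygon P) {x : S} (hx : x ∈ P) :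
    P = 𝓔.polygon x := by
  obtain ⟨y, -, rfl⟩ := hP
  exact 𝓔.polygon_eq hx

theorem smul_mem_liftedSupport {g : G} {x : S} :
    g • x ∈ 𝓔.liftedSupport ↔ x ∈ 𝓔.liftedSupport := by
  rw [liftedSupport, mem_preimage, mem_preimage, orbifoldProj_smul]

theorem smul_polygon_subset [ContinuousConstSMul G S] (g : G) {x y : S} (h : y ∈ 𝓔.polygon x) :
    g • y ∈ 𝓔.polygon (g • x) := by
  have hx : x ∈ 𝓔.liftedSupportᶜ := connectedComponentIn_nonempty_iff.1 ⟨y, h⟩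
  have h1 : IsPreconnected ((g • ·) '' 𝓔.polygon x) :=
    isPreconnected_connectedComponentIn.image _ (continuous_const_smul g).continuousOn
  refine 𝓔.subset_polygon h1 ?_ ⟨x, 𝓔.mem_polygon_self hx, rfl⟩
    (𝓔.mem_polygon_self (𝓔.smul_mem_liftedSupport.not.2 hx)) ⟨y, h, rfl⟩
  rintro _ ⟨w, hw, rfl⟩
  exact 𝓔.smul_mem_liftedSupport.not.2 (connectedComponentIn_subset _ _ hw)

section Regular

variable [Finite G] [T2Space S] [CompactSpace S] [IsConformalAction G S]

theorem isClosed_liftedSupport : IsClosed 𝓔.liftedSupport := by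
  have := IsConformalAction.continuousConstSMul G S
  have : T2Space (QuotientOrbifold G S) := t2Space_quotientOrbifold
  exact 𝓔.isClosed_support.preimage continuous_orbifoldProj

/-- Each lifted open polygon contains at most one point of every fibre of `π`, because the open
disc `T - 𝓔` is simply connected. -/
theorem eq_one_of_smul_mem_polygon {x : S} {g : G} (h : g • x ∈ 𝓔.polygon x) : g = 1 := by
  have hx : x ∉ 𝓔.liftedSupport := connectedComponentIn_nonempty_iff.1 ⟨_, h⟩
  have : LocallyPathConnectedSpace S := ChartedSpace.locallyPathConnectedSpace ℂ S
  have hopen : IsOpen (𝓔.polygon x) := 𝓔.isClosed_liftedSupport.isOpen_compl.connectedComponentIn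
  have hpc : IsPathConnected (𝓔.polygon x) :=
    hopen.isConnected_iff_isPathConnected.1 (isConnected_connectedComponentIn_iff.2 hx)
  obtain ⟨γ, hγ⟩ := hpc.joinedIn _ (𝓔.mem_polygon_self hx) _ h
  have hγs : ∀ t, γ t ∉ 𝓔.liftedSupport := fun t => connectedComponentIn_subset _ _ (hγ t)
  have hcone : ∀ p : (𝓔.supportᶜ : Set (QuotientOrbifold G S)), (p : QuotientOrbifold G S) ∉
      conePoints G S := fun p hp => p.2 (Or.inl (𝓔.conePoints_subset hp))
  have hreg : ∀ t, γ t ∈ regularPoints G S := fun t => by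
    simpa using (orbifoldProj_mem_conePoints_iff (G := G) (γ t)).not.1 (hcone ⟨_, hγs t⟩)
  have hcov := (isQuotientCoveringMap_regularProj G S)
  obtain ⟨Φ⟩ := 𝓔.complement_disc
  have : ContractibleSpace (Metric.ball (0 : ℂ) 1) :=
    (convex_ball (0 : ℂ) 1).contractibleSpace ⟨0, by simp⟩
  have : ContractibleSpace (𝓔.supportᶜ : Set (QuotientOrbifold G S)) := Φ.contractibleSpace
  let d : (𝓔.supportᶜ : Set (QuotientOrbifold G S)) := ⟨orbifoldProj G S x, hx⟩
  -- The projection of `γ` closes up because `x` and `g • x` lie in one orbit, and it is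
  -- null-homotopic in the disc.
  let β : Path d d :=
    { toFun := fun t => ⟨orbifoldProj G S (γ t), hγs t⟩
      continuous_toFun := (continuous_orbifoldProj.comp γ.continuous).subtype_mk _
      source' := by simp [d]
      target' := by simp [d, orbifoldProj_smul] }
  have hβ : β.Homotopic (Path.refl d) := SimplyConnectedSpace.paths_homotopic _ _
  let ι : C((𝓔.supportᶜ : Set (QuotientOrbifold G S)), PuncturedQuotient G S) :=
    ⟨fun p => ⟨p, hcone p⟩, continuous_subtype_val.subtype_mk _⟩
  let x' : regularPoints G S := ⟨x, by simpa using hreg 0⟩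
  let Γ : C(I, regularPoints G S) := ⟨fun t => ⟨γ t, hreg t⟩, γ.continuous.subtype_mk _⟩
  have hmap := hβ.map ι
  have h1 : Γ 1 = x' := by
    -- Lifts of homotopic paths from `x'` end at the same point. These lifts are `Γ` and the
    -- constant path, so `g` fixes the regular point `x`.
    have key := hcov.isCoveringMap.liftPath_apply_one_eq_of_homotopicRel hmap x'
      (by simp; rfl) (by simp; rfl)
    have e1 : Γ = hcov.isCoveringMap.liftPath (β.map ι.continuous).toContinuousMap x' (by simp; rfl) :=
      (hcov.isCoveringMap.eq_liftPath_iff' _).2 ⟨rfl, Subtype.ext γ.source⟩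
    have e2 : ContinuousMap.const I x' =
        hcov.isCoveringMap.liftPath ((Path.refl d).map ι.continuous).toContinuousMap x' (by simp; rfl) :=
      (hcov.isCoveringMap.eq_liftPath_iff' _).2 ⟨rfl, rfl⟩
    rw [← e1, ← e2] at key
    exact key
  have h2 : g • x = x := γ.target.symm.trans (congrArg Subtype.val h1)
  have h3 : g ∈ MulAction.stabilizer G x := h2
  rwa [show MulAction.stabilizer G x = ⊥ from x'.2] at h3

end Regular

end CutSystem

/-! ### Passing from one side of an edge to the other -/

namespace CutSystem

variable {G S : Type*} [Group G] [TopologicalSpace S] [ChartedSpace ℂ S] [MulAction G S]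

namespace IsEdgeBox

variable {𝓔 : CutSystem G S} {e : Fin 𝓔.k} {x : ℝ} {U : Set S} {ρ : S → ℝ}

theorem mem_liftedSupport_iff (hU : 𝓔.IsEdgeBox e x U ρ) {w : S} (hw : w ∈ U) :
    w ∈ 𝓔.liftedSupport ↔ ρ w = 0 :=
  hU.mem_support_iff w hw

/-- If both halves of a box contain a point of the polygon `P`, then both lie in `P`. -/
theorem mem_polygon_of_pos_of_neg (hU : 𝓔.IsEdgeBox e x U ρ) {u a b : S}
    (ha : a ∈ U) (hρa : 0 < ρ a) (hau : a ∈ 𝓔.polygon u)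
    (hb : b ∈ U) (hρb : ρ b < 0) (hbu : b ∈ 𝓔.polygon u) {w : S} (hw : w ∈ U)
    (hwL : w ∉ 𝓔.liftedSupport) : w ∈ 𝓔.polygon u := by
  rcases lt_or_gt_of_ne ((hU.mem_liftedSupport_iff hw).not.1 hwL) with h | h
  · exact 𝓔.subset_polygon (hU.isPreconnected (Iio 0) (convex_Iio 0))
      (fun y hy => (hU.mem_liftedSupport_iff hy.1).not.2 (ne_of_lt hy.2)) ⟨hb, hρb⟩ hbu ⟨hw, h⟩
  · exact 𝓔.subset_polygon (hU.isPreconnected (Ioi 0) (convex_Ioi 0))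
      (fun y hy => (hU.mem_liftedSupport_iff hy.1).not.2 (ne_of_gt hy.2)) ⟨ha, hρa⟩ hau ⟨hw, h⟩

/-- If a polygon fills a punctured neighbourhood of a point of the edge in a box, then it fills the
whole box. -/
theorem mem_polygon_of_eventually (hU : 𝓔.IsEdgeBox e x U ρ) {u z : S} (hz : z ∈ U)
    (hzL : z ∈ 𝓔.liftedSupport) (h : ∀ᶠ y in 𝓝 z, y ∉ 𝓔.liftedSupport → y ∈ 𝓔.polygon u)
    {w : S} (hw : w ∈ U) (hwL : w ∉ 𝓔.liftedSupport) : w ∈ 𝓔.polygon u := by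
  -- The transversal through `z` supplies a point of each half as close to `z` as needed.
  obtain ⟨c, hc, hc0, hcU⟩ := hU.exists_transversal z hz ((hU.mem_liftedSupport_iff hz).1 hzL)
  have h1 : ∀ᶠ t in 𝓝 (0 : ℝ), c t ∉ 𝓔.liftedSupport → c t ∈ 𝓔.polygon u :=
    hc.eventually (by rwa [hc0])
  have h2 := hcU.and h1
  obtain ⟨t, ht, ht0⟩ := ((h2.filter_mono nhdsWithin_le_nhds).and
    (self_mem_nhdsWithin : Ioi (0 : ℝ) ∈ 𝓝[>] 0)).exists
  obtain ⟨s, hs, hs0⟩ := ((h2.filter_mono nhdsWithin_le_nhds).and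
    (self_mem_nhdsWithin : Iio (0 : ℝ) ∈ 𝓝[<] 0)).exists
  have ht0' : 0 < ρ (c t) := ht.1.2.symm ▸ ht0
  have hs0' : ρ (c s) < 0 := hs.1.2.symm ▸ hs0
  exact hU.mem_polygon_of_pos_of_neg ht.1.1 ht0'
    (ht.2 ((hU.mem_liftedSupport_iff ht.1.1).not.2 ht0'.ne')) hs.1.1 hs0'
    (hs.2 ((hU.mem_liftedSupport_iff hs.1.1).not.2 hs0'.ne)) hw hwL

/-- The local step of both connectedness arguments below: the polygon filling both sides at one edge
point of a box does so throughout the box. -/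
theorem eventually_mem_polygon (hU : 𝓔.IsEdgeBox e x U ρ) {u z w : S} (hz : z ∈ U)
    (hzL : z ∈ 𝓔.liftedSupport) (h : ∀ᶠ y in 𝓝 z, y ∉ 𝓔.liftedSupport → y ∈ 𝓔.polygon u)
    (hw : w ∈ U) : ∀ᶠ y in 𝓝 w, y ∉ 𝓔.liftedSupport → y ∈ 𝓔.polygon u := by
  filter_upwards [hU.isOpen.mem_nhds hw] with y hy hyL
  exact hU.mem_polygon_of_eventually hz hzL h hy hyL

end IsEdgeBox

end CutSystem

/-- If one sign did not occur near `t`, then `t` would be a local extremum and the derivative would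
vanish. -/
theorem HasDerivAt.frequently_pos_and_neg {f : ℝ → ℝ} {d t : ℝ} (hf : HasDerivAt f d t)
    (hd : d ≠ 0) (h0 : f t = 0) : (∃ᶠ s in 𝓝 t, 0 < f s) ∧ ∃ᶠ s in 𝓝 t, f s < 0 := by
  constructor <;> intro h <;> simp only [not_lt] at h
  · exact hd (IsLocalMax.hasDerivAt_eq_zero (by simpa [IsLocalMax, IsMaxFilter, h0] using h) hf)
  · exact hd (IsLocalMin.hasDerivAt_eq_zero (by simpa [IsLocalMin, IsMinFilter, h0] using h) hf)

namespace CutSystem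

variable {G S : Type*} [Group G] [Finite G] [TopologicalSpace S] [T2Space S] [CompactSpace S]
  [ChartedSpace ℂ S] [MulAction G S] [IsConformalAction G S] {𝓔 : CutSystem G S} {e : Fin 𝓔.k}

/-- A curve in `S` whose image in `T` crosses `e` transversally passes from one half of an edge box
to the other. -/
theorem IsEdgeBox.frequently_pos_and_neg [IsManifold 𝓘(ℂ) ω S] {x : ℝ} {U : Set S} {ρ : S → ℝ}
    (hU : 𝓔.IsEdgeBox e x U ρ) (hx : x ∈ Ioo (0 : ℝ) 1) {γ : ℝ → S} {t : ℝ}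
    (hγ : ContinuousAt γ t) (hγU : γ t ∈ U) (hγx : orbifoldProj G S (γ t) = 𝓔.arc e x)
    {φ : OpenPartialHomeomorph (QuotientOrbifold G S) ℂ} (hφ : IsQuotientChart G S φ)
    (hxφ : 𝓔.arc e x ∈ φ.source) {a b : ℂ} (ha : HasDerivAt (fun s => φ (𝓔.arc e s)) a x)
    (hb : HasDerivAt (fun s => φ (orbifoldProj G S (γ s))) b t)
    (hab : LinearIndependent ℝ ![a, b]) :
    (∃ᶠ s in 𝓝 t, 0 < ρ (γ s)) ∧ ∃ᶠ s in 𝓝 t, ρ (γ s) < 0 := by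
  obtain ⟨φ₁, hφ₁, hxφ₁, a₁, ha₁, h, L, hL, hρ, hker⟩ := hU.exists_chart
  have hcone := EmbeddedGraph.notMem_conePoints_of_mem_openEdge 𝓔.conePoints_subset
    (p := 𝓔.arc e x) (e := e) ⟨x, hx, rfl⟩
  obtain ⟨c, hc, hcd⟩ := hφ₁.exists_hasDerivAt_transition hφ hcone hxφ₁ hxφ
  have harc : ContinuousAt (𝓔.arc e) x :=
    (𝓔.continuousOn_arc e).continuousAt (Icc_mem_nhds hx.1 hx.2)
  have ha₁' : a₁ = c * a := ha₁.unique (ha.quotientChart_transition harc hxφ hcd)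
  have hb₁ : HasDerivAt (fun s => φ₁ (orbifoldProj G S (γ s))) (c * b) t :=
    hb.quotientChart_transition (continuous_orbifoldProj.continuousAt.comp hγ)
      (hγx ▸ hxφ) (by rwa [hγx])
  -- The kernel of `L` is contained in the real line through `c a`, the tangent of `e` read in `φ₁`;
  -- a zero value would make `b` a real multiple of `a`.
  have hLb : L (c * b) ≠ 0 := by
    intro h0
    obtain ⟨r, hr⟩ := hker _ h0
    have hbr : b = r • a := by
      refine mul_left_cancel₀ hc ?_
      rw [hr, ha₁', mul_smul_comm]
    have := LinearIndependent.pair_iff.1 hab r (-1) (by simp [hbr])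
    simp at this
  have hd : HasDerivAt (fun s => ρ (γ s)) (L (c * b)) t := by
    have h1 : HasDerivAt (fun s => h (φ₁ (orbifoldProj G S (γ s)))) (L (c * b)) t :=
      HasFDerivAt.comp_hasDerivAt_of_eq (l := h) t hL hb₁ (by rw [hγx])
    refine h1.congr_of_eventuallyEq ?_
    filter_upwards [hγ (hU.isOpen.mem_nhds hγU)] with s hs
    exact hρ _ hs
  refine hd.frequently_pos_and_neg hLb ((hU.mem_support_iff _ hγU).1 ?_)
  rw [hγx]
  exact 𝓔.openEdge_subset_support e ⟨x, hx, rfl⟩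

/-- If both sides of one point over an interior point of `e` lie in the same polygon, then this
holds at all points over the open edge `e`. -/
theorem exists_eventually_mem_polygon {x : ℝ} (hx : x ∈ Ioo (0 : ℝ) 1) {z u : S}
    (hz : orbifoldProj G S z = 𝓔.arc e x)
    (h : ∀ᶠ y in 𝓝 z, y ∉ 𝓔.liftedSupport → y ∈ 𝓔.polygon u) {z' : S}
    (hz' : orbifoldProj G S z' ∈ 𝓔.openEdge e) :
    ∃ u', ∀ᶠ y in 𝓝 z', y ∉ 𝓔.liftedSupport → y ∈ 𝓔.polygon u' := by
  have := IsConformalAction.continuousConstSMul G S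
  -- Asking for only one point of the fibre allows the induction to run over the interval `(0, 1)`,
  -- although the preimage of `e` may be disconnected; `hA` then reaches the whole fibre by means of
  -- `G`.
  let A : ℝ → Prop := fun s => ∃ z u, orbifoldProj G S z = 𝓔.arc e s ∧
    ∀ᶠ y in 𝓝 z, y ∉ 𝓔.liftedSupport → y ∈ 𝓔.polygon u
  have hA : ∀ s, A s → ∀ z', orbifoldProj G S z' = 𝓔.arc e s →
      ∃ u', ∀ᶠ y in 𝓝 z', y ∉ 𝓔.liftedSupport → y ∈ 𝓔.polygon u' := by
    rintro s ⟨z, u, hz, h⟩ z' hz'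
    obtain ⟨g, rfl⟩ := orbifoldProj_eq_iff.1 (hz.trans hz'.symm)
    refine ⟨g⁻¹ • u, ?_⟩
    have h1 : Tendsto (g • · : S → S) (𝓝 z') (𝓝 (g • z')) := (continuous_const_smul g).tendsto z'
    filter_upwards [h1.eventually h] with y hy hyL
    simpa using 𝓔.smul_polygon_subset g⁻¹ (hy (𝓔.smul_mem_liftedSupport.not.2 hyL))
  have hL : ∀ s ∈ Ioo (0 : ℝ) 1, ∀ w, orbifoldProj G S w = 𝓔.arc e s → w ∈ 𝓔.liftedSupport :=
    fun s hs w hw => 𝓔.openEdge_subset_support e ⟨s, hs, hw.symm⟩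
  obtain ⟨x', hx', hzx'⟩ := hz'
  refine hA x' ?_ z' hzx'.symm
  refine isPreconnected_Ioo.induction₂' (fun s s' => A s → A s') (fun s hs => ?_)
    (fun _ _ _ _ _ _ h1 h2 h3 => h2 (h1 h3)) hx hx' ⟨z, u, hz, h⟩
  obtain ⟨w, hw⟩ := surjective_orbifoldProj (𝓔.arc e s)
  obtain ⟨U, ρ, hwU, hU⟩ := 𝓔.exists_isEdgeBox e hs hw
  filter_upwards [hU.eventually_exists_arc.filter_mono nhdsWithin_le_nhds,
    self_mem_nhdsWithin] with s' hs' hs'I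
  obtain ⟨w', hw'U, hw'⟩ := hs'
  constructor
  · intro h1
    obtain ⟨u', hu'⟩ := hA s h1 w hw
    exact ⟨w', u', hw', hU.eventually_mem_polygon hwU (hL s hs w hw) hu' hw'U⟩
  · intro h1
    obtain ⟨u', hu'⟩ := hA s' h1 w' hw'
    exact ⟨w, u', hw, hU.eventually_mem_polygon hw'U (hL s' hs'I w' hw') hu' hwU⟩

/-- If both sides of one point over an interior point of `e` lie in the same polygon, then there is
an edge collapse at every edge over `e`. -/
theorem edgeCollapse_of_eventually_mem_polygon {x : ℝ} (hx : x ∈ Ioo (0 : ℝ) 1) {z u : S}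
    (hz : orbifoldProj G S z = 𝓔.arc e x)
    (h : ∀ᶠ y in 𝓝 z, y ∉ 𝓔.liftedSupport → y ∈ 𝓔.polygon u) {l : Set S}
    (hl : 𝓔.IsLiftedEdge e l) : 𝓔.EdgeCollapse l := by
  obtain ⟨y, hy, rfl⟩ := hl
  set l := connectedComponentIn (orbifoldProj G S ⁻¹' 𝓔.openEdge e) y with hl
  have hyl : y ∈ l := mem_connectedComponentIn hy
  have hle : l ⊆ orbifoldProj G S ⁻¹' 𝓔.openEdge e := connectedComponentIn_subset _ _
  have hlL : l ⊆ 𝓔.liftedSupport := fun w hw => 𝓔.openEdge_subset_support e (hle hw)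
  have hbox : ∀ w ∈ l, ∃ s U ρ, w ∈ U ∧ 𝓔.IsEdgeBox e s U ρ := by
    intro w hw
    obtain ⟨s, hs, hsw⟩ := hle hw
    obtain ⟨U, ρ, hwU, hU⟩ := 𝓔.exists_isEdgeBox e hs hsw.symm
    exact ⟨s, U, ρ, hwU, hU⟩
  obtain ⟨u', hu'⟩ := exists_eventually_mem_polygon hx hz h hy
  -- Along the connected edge `l` the same polygon serves at every point.
  have hall : ∀ w ∈ l, ∀ᶠ v in 𝓝 w, v ∉ 𝓔.liftedSupport → v ∈ 𝓔.polygon u' := by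
    intro w hw
    refine isPreconnected_connectedComponentIn.induction₂'
      (fun w w' => (∀ᶠ v in 𝓝 w, v ∉ 𝓔.liftedSupport → v ∈ 𝓔.polygon u') →
        ∀ᶠ v in 𝓝 w', v ∉ 𝓔.liftedSupport → v ∈ 𝓔.polygon u') (fun v hv => ?_)
      (fun _ _ _ _ _ _ h1 h2 h3 => h2 (h1 h3)) hyl hw hu'
    obtain ⟨s, U, ρ, hvU, hU⟩ := hbox v hv
    filter_upwards [mem_nhdsWithin_of_mem_nhds (hU.isOpen.mem_nhds hvU),
      self_mem_nhdsWithin] with v' hv'U hv'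
    exact ⟨fun h1 => hU.eventually_mem_polygon hvU (hlL hv) h1 hv'U,
      fun h1 => hU.eventually_mem_polygon hv'U (hlL hv') h1 hvU⟩
  choose! s U ρ hmem hU using hbox
  have hN : (⋃ w ∈ l, U w) \ l ⊆ 𝓔.polygon u' := by
    rintro v ⟨hv, hvl⟩
    obtain ⟨w, hw, hvw⟩ := mem_iUnion₂.1 hv
    refine (hU w hw).mem_polygon_of_eventually (hmem w hw) (hlL hw) (hall w hw) hvw fun hvL => ?_
    have h0 : ∀ v ∈ U w, v ∈ 𝓔.liftedSupport → v ∈ {v ∈ U w | ρ w v ∈ ({0} : Set ℝ)} :=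
      fun v hv hvL => ⟨hv, ((hU w hw).mem_liftedSupport_iff hv).1 hvL⟩
    -- The zero slice of a box is connected and lies over `e`, so it belongs to the component `l`.
    -- Hence a box meets the lifted graph only in `l`.
    have h1 : {v ∈ U w | ρ w v ∈ ({0} : Set ℝ)} ⊆ l := by
      rw [hl, connectedComponentIn_eq hw]
      exact ((hU w hw).isPreconnected {0} (convex_singleton 0)).subset_connectedComponentIn
        (h0 w (hmem w hw) (hlL hw)) fun v hv => (hU w hw).mem_openEdge v hv.1 hv.2
    exact hvl (h1 (h0 v hvw hvL))
  -- The component in a set of a point outside it is empty, so a point found in the polygon of `u'`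
  -- shows that `u'` is off the graph.
  have hu'L : u' ∉ 𝓔.liftedSupport := by
    obtain ⟨c, hc, hc0, hcU⟩ := (hU y hyl).exists_transversal y (hmem y hyl)
      (((hU y hyl).mem_liftedSupport_iff (hmem y hyl)).1 (hlL hyl))
    obtain ⟨t, ht, ht0⟩ := ((hcU.filter_mono nhdsWithin_le_nhds).and
      (self_mem_nhdsWithin : Ioi (0 : ℝ) ∈ 𝓝[>] 0)).exists
    have hmem' : c t ∈ 𝓔.polygon u' := (hU y hyl).mem_polygon_of_eventually (hmem y hyl) (hlL hyl)
      hu' ht.1 (((hU y hyl).mem_liftedSupport_iff ht.1).not.2 (ht.2.symm ▸ (ne_of_gt ht0)))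
    exact connectedComponentIn_nonempty_iff.1 ⟨_, hmem'⟩
  exact ⟨𝓔.polygon u', ⟨u', hu'L, rfl⟩, ⋃ w ∈ l, U w, isOpen_biUnion fun w hw => (hU w hw).isOpen,
    fun w hw => mem_biUnion hw (hmem w hw), hN⟩

/-- The lift of a crossover loop runs from `x₀` to `τ x₀`; before the crossing it stays in the
polygon of `x₀`, and after it in the polygon of `τ x₀`. -/
theorem IsCrossoverLoop.exists_lift {v₀ : PuncturedQuotient G S} {δ : Path v₀ v₀}
    (x₀ : regularProj G S ⁻¹' {v₀}) {t₀ : I} (h₀ : (δ t₀ : QuotientOrbifold G S) ∈ 𝓔.support)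
    (hv₀ : (v₀ : QuotientOrbifold G S) ∉ 𝓔.support)
    (huniq : ∀ t : I, (δ t : QuotientOrbifold G S) ∈ 𝓔.support → t = t₀) :
    ∃ Γ : ℝ → S, Continuous Γ ∧
      (∀ t, orbifoldProj G S (Γ t) = (δ.extend t : QuotientOrbifold G S)) ∧
      (∀ t < (t₀ : ℝ), Γ t ∈ 𝓔.polygon ((x₀ : regularPoints G S) : S)) ∧
      ∀ t > (t₀ : ℝ), Γ t ∈ 𝓔.polygon
        (crossoverTransformation x₀ δ • ((x₀ : regularPoints G S) : S)) := by
  have hcov := isQuotientCoveringMap_regularProj G S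
  have hx₀ : regularProj G S x₀ = v₀ := x₀.2
  set Γ₀ := hcov.isCoveringMap.liftPath δ (x₀ : regularPoints G S) (δ.source.trans hx₀.symm)
    with hΓ₀
  have hlift : ∀ t, regularProj G S (Γ₀ t) = δ t := fun t =>
    congrFun (hcov.isCoveringMap.liftPath_lifts _ _ _) t
  have hzero : Γ₀ 0 = x₀ := hcov.isCoveringMap.liftPath_zero _ _ _
  have hone : Γ₀ 1 = crossoverTransformation x₀ δ • (x₀ : regularPoints G S) :=
    (hcov.unop_fundamentalGroupToMulOpposite_smul (e := x₀)
      (γ := FundamentalGroup.fromPath (Path.Homotopic.Quotient.mk δ))).symm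
  -- The extension is constant outside `[0, 1]`, so both open half-lines at `t₀` are mapped off the
  -- graph; their images are connected and contain `x₀` and `τ x₀`.
  let Γ : ℝ → S := fun t => Γ₀ (projIcc 0 1 zero_le_one t)
  have hΓ : Continuous Γ :=
    continuous_subtype_val.comp (Γ₀.continuous.comp continuous_projIcc)
  have hproj : ∀ t, orbifoldProj G S (Γ t) = (δ.extend t : QuotientOrbifold G S) := fun t =>
    congrArg Subtype.val (hlift (projIcc 0 1 zero_le_one t))
  have ht₀ : (0 : ℝ) < t₀ ∧ (t₀ : ℝ) < 1 := by
    constructor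
    · refine lt_of_le_of_ne t₀.2.1 fun h => hv₀ ?_
      have : t₀ = 0 := Subtype.ext h.symm
      rwa [this, δ.source] at h₀
    · refine lt_of_le_of_ne t₀.2.2 fun h => hv₀ ?_
      have : t₀ = 1 := Subtype.ext h
      rwa [this, δ.target] at h₀
  have hoff : ∀ t : ℝ, t ≠ t₀ → Γ t ∉ 𝓔.liftedSupport := by
    intro t ht hL
    have h1 : (δ (projIcc 0 1 zero_le_one t) : QuotientOrbifold G S) ∈ 𝓔.support := by
      rw [← hlift]
      exact hL
    have h2 := congrArg Subtype.val (huniq _ h1)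
    rcases le_total t 0 with h | h
    · rw [projIcc_of_le_left _ h] at h2
      exact ht₀.1.ne h2
    rcases le_total 1 t with h' | h'
    · rw [projIcc_of_right_le _ h'] at h2
      exact ht₀.2.ne' h2
    · rw [projIcc_of_mem _ ⟨h, h'⟩] at h2
      exact ht h2
  refine ⟨Γ, hΓ, hproj, fun t ht => ?_, fun t ht => ?_⟩
  · refine 𝓔.subset_polygon (isPreconnected_Iio.image Γ hΓ.continuousOn) ?_
      ⟨0, ht₀.1, by simp [Γ, hzero]⟩ (𝓔.mem_polygon_self ?_) ⟨t, ht, rfl⟩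
    · rintro _ ⟨s, hs, rfl⟩
      exact hoff s (ne_of_lt hs)
    · simpa [Γ, hzero] using hoff 0 ht₀.1.ne
  · refine 𝓔.subset_polygon (isPreconnected_Ioi.image Γ hΓ.continuousOn) ?_
      ⟨1, ht₀.2, by simp [Γ, hone]⟩ (𝓔.mem_polygon_self ?_) ⟨t, ht, rfl⟩
    · rintro _ ⟨s, hs, rfl⟩
      exact hoff s (ne_of_gt hs)
    · simpa [Γ, hone] using hoff 1 ht₀.2.ne'

end CutSystem

/-! ### The criterion for edge collapse -/

theorem mainTheorem4 {S : Type*} [TopologicalSpace S] [T2Space S] [CompactSpace S]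
    [ConnectedSpace S] [ChartedSpace ℂ S] [IsManifold 𝓘(ℂ) ω S]
    {G : Type*} [Group G] [Finite G] [MulAction G S] [IsConformalAction G S]
    (𝓔 : CutSystem G S) (e : Fin 𝓔.k)
    {v₀ : PuncturedQuotient G S} (x₀ : regularProj G S ⁻¹' {v₀})
    (δ : Path v₀ v₀) (hδ : 𝓔.IsCrossoverLoop e δ) :
    (∀ l : Set S, 𝓔.IsLiftedEdge e l → 𝓔.EdgeCollapse l) ↔
      crossoverTransformation x₀ δ = 1 := by
  obtain ⟨t₀, x, hx, hδx, huniq, φ, hφ, hxφ, a, b, ha, hb, hab⟩ := hδ.crossing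
  have hedge : 𝓔.arc e x ∈ 𝓔.openEdge e := ⟨x, hx, rfl⟩
  obtain ⟨Γ, hΓ, hproj, hbefore, hafter⟩ := CutSystem.IsCrossoverLoop.exists_lift x₀
    (hδx ▸ 𝓔.openEdge_subset_support e hedge) hδ.base_notMem huniq
  have hΓx : orbifoldProj G S (Γ t₀) = 𝓔.arc e x := by
    rw [hproj, Path.extend_extends', hδx]
  constructor
  · intro h
    -- Only the collapse at the edge through the crossing point `Γ t₀` is needed.
    obtain ⟨P, hP, N, hN, hlN, hNP⟩ := h _ ⟨Γ t₀, by rwa [mem_preimage, hΓx], rfl⟩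
    have hmem : Γ t₀ ∈ N := hlN (mem_connectedComponentIn (by rwa [mem_preimage, hΓx]))
    have hev : ∀ᶠ t in 𝓝 (t₀ : ℝ), Γ t ∈ N := hΓ.continuousAt (hN.mem_nhds hmem)
    have key : ∀ u t, Γ t ∈ N → Γ t ∈ 𝓔.polygon u → P = 𝓔.polygon u := by
      intro u t htN htu
      have htP : Γ t ∈ P := hNP ⟨htN, fun htl => connectedComponentIn_subset _ _ htu
        (𝓔.openEdge_subset_support e
          (connectedComponentIn_subset (orbifoldProj G S ⁻¹' 𝓔.openEdge e) _ htl))⟩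
      rw [hP.eq_polygon 𝓔 htP, 𝓔.polygon_eq htu]
    obtain ⟨s, hsN, hs⟩ := ((hev.filter_mono nhdsWithin_le_nhds).and
      (self_mem_nhdsWithin : Iio (t₀ : ℝ) ∈ 𝓝[<] (t₀ : ℝ))).exists
    obtain ⟨t, htN, ht⟩ := ((hev.filter_mono nhdsWithin_le_nhds).and
      (self_mem_nhdsWithin : Ioi (t₀ : ℝ) ∈ 𝓝[>] (t₀ : ℝ))).exists
    refine 𝓔.eq_one_of_smul_mem_polygon (x := ((x₀ : regularPoints G S) : S)) ?_
    -- Times just before and just after `t₀` identify `P` with the polygons of `x₀` and of `τ x₀`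
    -- respectively.
    rw [← key _ s hsN (hbefore s hs), key _ t htN (hafter t ht)]
    exact 𝓔.mem_polygon_self (connectedComponentIn_nonempty_iff.1 ⟨_, hafter t ht⟩)
  · intro hτ l hl
    rw [hτ, one_smul] at hafter
    obtain ⟨U, ρ, hU₀, hU⟩ := 𝓔.exists_isEdgeBox e hx hΓx
    have hb' : HasDerivAt (fun s => φ (orbifoldProj G S (Γ s))) b t₀ := by
      simpa only [hproj] using hb
    obtain ⟨hpos, hneg⟩ :=
      hU.frequently_pos_and_neg hx hΓ.continuousAt hU₀ hΓx hφ hxφ ha hb' hab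
    have hev : ∀ᶠ t in 𝓝 (t₀ : ℝ), Γ t ∈ U := hΓ.continuousAt (hU.isOpen.mem_nhds hU₀)
    -- With `τ = 1` both parts of `Γ` lie in the polygon of `x₀`, so it does not matter which sign
    -- of `ρ` comes before the crossing.
    have hmem : ∀ t, Γ t ∈ U → ρ (Γ t) ≠ 0 → Γ t ∈ 𝓔.polygon ((x₀ : regularPoints G S) : S) := by
      intro t htU ht
      rcases lt_trichotomy t t₀ with h | rfl | h
      · exact hbefore t h
      · refine absurd ((hU.mem_support_iff _ hU₀).1 ?_) ht
        rw [hΓx]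
        exact 𝓔.openEdge_subset_support e hedge
      · exact hafter t h
    obtain ⟨s, hs, hsU⟩ := (hpos.and_eventually hev).exists
    obtain ⟨t, ht, htU⟩ := (hneg.and_eventually hev).exists
    refine CutSystem.edgeCollapse_of_eventually_mem_polygon hx hΓx
      (u := ((x₀ : regularPoints G S) : S)) ?_ hl
    filter_upwards [hU.isOpen.mem_nhds hU₀] with y hy hyL
    exact hU.mem_polygon_of_pos_of_neg hsU hs (hmem s hsU hs.ne') htU ht (hmem t htU ht.ne) hy hyL
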